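/- Let $D\subset\mathbb R^d$ be a bounded, open, connected set whose boundary is split as $\partial D=A\cup R$, $A\cap R=\emptyset$, where the absorbing part $A$ is closed and non-empty and the reflecting part $R=\partial D\setminus A$ (possibly empty) is of class $C^2$, that is, near each of its points $D$ is $\{\rho<0\}$ for a $C^2$ function $\rho$ that vanishes, with non-zero gradient, at that point; let $N=\nabla\rho/\|\nabla\rho\|$ be the outward unit normal on $R$. Let $\sigma$ be a constant $d\times d$ matrix such that the generator $\mathcal L=\frac12\sum_{i,j}(\sigma\sigma^\top)_{ij}\,\partial_i\partial_j$ equals $\kappa\Delta$ for a constant $\kappa>0$. For $x\in\overline D$ let $X$ be the associated diffusion started at $x$, normally reflected on $R$ and stopped on $A$: with a $d$-dimensional Wiener process $W$ and a continuous nondecreasing process $\xi$, $\xi_0=0$ (the local time), almost surely $$X_t=x+\sigma W_t-\int_0^t N(X_s)\,d\xi_s,\qquad X_t\in\overline D,\qquad \int_0^t \mathbb 1_{\{X_s\notin R\}}\,d\xi_s=0\qquad(t\le\tau,\ t<\infty),$$ where $\tau=\tau^{D}(x)=\inf\{t\ge0: X_t\in A\}\in[0,\infty]$ is the first exit time. Let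 $\Lambda>0$, $D'=\Lambda D=\{\Lambda x:x\in D\}$, with absorbing part $A'=\Lambda A$ and reflecting part $R'=\Lambda R$. Then for every $z\in\overline{D'}$, $$\mathbb E[\tau^{D'}(z)]=\Lambda^2\,\mathbb E[\tau^{D}(z/\Lambda)]$$ in $[0,\infty]$, for any realisation of the diffusion in $D$ started at $z/\Lambda$ and any realisation of the diffusion in $D'$ started at $z$, on whatever probability spaces they are defined. -/

import Mathlib

open MeasureTheory ProbabilityTheory Set
open scoped NNReal ENNReal Topology Pointwise

noncomputable section

/-- The driftless second order operator
`f ↦ (1/2) ∑ i j, (σ σᵀ) i j ∂ᵢ∂ⱼ f` with constant coefficients. -/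
def diffusionGenerator {d : ℕ} (σ : Matrix (Fin d) (Fin d) ℝ)
    (f : EuclideanSpace ℝ (Fin d) → ℝ) (x : EuclideanSpace ℝ (Fin d)) : ℝ :=
  (1 / 2 : ℝ) * ∑ i, ∑ j, (σ * σ.transpose) i j *
    iteratedFDeriv ℝ 2 f x ![EuclideanSpace.single i 1, EuclideanSpace.single j 1]

/-- `ρ` is a `C²` defining function of the open set `D` near its boundary point `p`: around `p`,
the set `D` is `{ρ < 0}`, while `ρ p = 0` and the gradient of `ρ` at `p` does not vanish. So `∂D` is
of class `C²` around `p`, with `D` on one side of it. -/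
structure IsDefiningFunctionAt {d : ℕ} (D : Set (EuclideanSpace ℝ (Fin d)))
    (p : EuclideanSpace ℝ (Fin d)) (ρ : EuclideanSpace ℝ (Fin d) → ℝ) : Prop where
  contDiffAt : ContDiffAt ℝ 2 ρ p
  eq_zero : ρ p = 0
  gradient_ne_zero : gradient ρ p ≠ 0
  mem_iff : ∀ᶠ y in 𝓝 p, (y ∈ D ↔ ρ y < 0)

open Classical in
/-- The outward unit normal `N(p)` to `∂D` at `p`, computed from a defining function of `D` near
`p` (all of them give the same vector, see `outwardNormal_eq`). It is `0` where there is none. -/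
def outwardNormal {d : ℕ} (D : Set (EuclideanSpace ℝ (Fin d)))
    (p : EuclideanSpace ℝ (Fin d)) : EuclideanSpace ℝ (Fin d) :=
  if h : ∃ ρ, IsDefiningFunctionAt D p ρ then
    ‖gradient h.choose p‖⁻¹ • gradient h.choose p
  else 0

/-- Along a ray on which a function vanishing at `p` decreases to first order, it is negative
just after `p`. -/
theorem eventually_neg_of_fderiv_neg {d : ℕ} {p v : EuclideanSpace ℝ (Fin d)}
    {ρ : EuclideanSpace ℝ (Fin d) → ℝ} (h : DifferentiableAt ℝ ρ p) (h0 : ρ p = 0)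
    (hv : fderiv ℝ ρ p v < 0) : ∀ᶠ t : ℝ in 𝓝[>] 0, ρ (p + t • v) < 0 := by
  have hd : HasDerivAt (fun t : ℝ => ρ (p + t • v)) (fderiv ℝ ρ p v) 0 := by
    have h1 : HasFDerivAt ρ (fderiv ℝ ρ p) (p + (0 : ℝ) • v) := by
      simpa using h.hasFDerivAt
    have h2 : HasDerivAt (fun t : ℝ => p + t • v) v 0 := by
      simpa using ((hasDerivAt_id (0 : ℝ)).smul_const v).const_add p
    exact h1.comp_hasDerivAt (0 : ℝ) h2
  have hs := hd.tendsto_slope_zero_right.eventually (gt_mem_nhds hv)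
  filter_upwards [hs, self_mem_nhdsWithin] with t ht htpos
  have htp : (0 : ℝ) < t := htpos
  simp only [zero_add, zero_smul, add_zero, h0, sub_zero, smul_eq_mul] at ht
  by_contra hc
  have := mul_nonneg (inv_pos.2 htp).le (not_lt.1 hc)
  linarith

/-- The outward unit normal does not depend on the defining function. -/
theorem outwardNormal_eq {d : ℕ} {D : Set (EuclideanSpace ℝ (Fin d))}
    {p : EuclideanSpace ℝ (Fin d)} {ρ : EuclideanSpace ℝ (Fin d) → ℝ}
    (h : IsDefiningFunctionAt D p ρ) :
    outwardNormal D p = ‖gradient ρ p‖⁻¹ • gradient ρ p := by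
  have hex : ∃ ρ, IsDefiningFunctionAt D p ρ := ⟨ρ, h⟩
  rw [outwardNormal, dif_pos hex]
  have h' := hex.choose_spec
  set ρ' := hex.choose
  set a := gradient ρ p
  set b := gradient ρ' p
  by_contra hne
  have ha : 0 < ‖a‖ := norm_pos_iff.2 h.gradient_ne_zero
  have hb : 0 < ‖b‖ := norm_pos_iff.2 h'.gradient_ne_zero
  have hna : ‖‖a‖⁻¹ • a‖ = 1 := norm_smul_inv_norm (𝕜 := ℝ) h.gradient_ne_zero
  have hnb : ‖‖b‖⁻¹ • b‖ = 1 := norm_smul_inv_norm (𝕜 := ℝ) h'.gradient_ne_zero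
  have hlt : inner ℝ (‖a‖⁻¹ • a) (‖b‖⁻¹ • b) < 1 :=
    (inner_lt_one_iff_real_of_norm_eq_one hna hnb).2 (Ne.symm hne)
  set v := ‖b‖⁻¹ • b - ‖a‖⁻¹ • a with hv
  have hva : inner ℝ (‖a‖⁻¹ • a) v < 0 := by
    rw [hv, inner_sub_right, real_inner_self_eq_norm_sq, hna]; linarith
  have hvb : 0 < inner ℝ (‖b‖⁻¹ • b) v := by
    rw [hv, inner_sub_right, real_inner_self_eq_norm_sq, hnb, real_inner_comm]; linarith
  rw [real_inner_smul_left] at hva hvb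
  have hva' : fderiv ℝ ρ p v < 0 := by
    have e : fderiv ℝ ρ p v = inner ℝ a v := by simp [a, gradient]
    rw [e]
    by_contra hc
    have := mul_nonneg (inv_pos.2 ha).le (not_lt.1 hc)
    linarith
  have hvb' : fderiv ℝ (-ρ') p v < 0 := by
    have e : fderiv ℝ ρ' p v = inner ℝ b v := by simp [b, gradient]
    rw [fderiv_neg, neg_apply, e]
    have := pos_of_mul_pos_right hvb (inv_pos.2 hb).le
    linarith
  have h1 := eventually_neg_of_fderiv_neg (h.contDiffAt.differentiableAt (by norm_num))
    h.eq_zero hva'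
  have h2 := eventually_neg_of_fderiv_neg (h'.contDiffAt.differentiableAt (by norm_num)).neg
    (by simp [h'.eq_zero]) hvb'
  have hlim : Filter.Tendsto (fun t : ℝ => p + t • v) (𝓝[>] 0) (𝓝 p) := by
    have hc : Continuous fun t : ℝ => p + t • v := by fun_prop
    simpa using (hc.tendsto 0).mono_left nhdsWithin_le_nhds
  obtain ⟨t, ht1, ht2, ht3, ht4⟩ :=
    (h1.and (h2.and ((hlim.eventually h.mem_iff).and (hlim.eventually h'.mem_iff)))).exists
  have := ht4.1 (ht3.2 ht1)
  simp only [Pi.neg_apply] at ht2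
  linarith

/-- A `d`-dimensional Wiener process started at the origin: the coordinates are independent
one-dimensional Brownian motions. -/
structure IsWienerProcess {d : ℕ} {S : Type*} [MeasurableSpace S] (P : Measure S)
    (W : ℝ≥0 → S → EuclideanSpace ℝ (Fin d)) : Prop where
  isBrownianReal : ∀ i, IsBrownianReal (fun t ω => W t ω i) P
  iIndepFun : iIndepFun (fun (i : Fin d) (ω : S) (t : ℝ≥0) => W t ω i) P

/-- The first exit time `inf {t ≥ 0 | X t ∈ A}` through the absorbing boundary `A`, with value
`∞` if `A` is never hit. (For a path that starts outside `A` this is the same as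
`inf {t > 0 | X t ∈ A}`; for a path that starts in `A` it is `0`.) -/
def exitTime {d : ℕ} {S : Type*} (A : Set (EuclideanSpace ℝ (Fin d)))
    (X : ℝ≥0 → S → EuclideanSpace ℝ (Fin d)) (ω : S) : ℝ≥0∞ :=
  hittingAfter X A 0 ω

/-- The path `p` with local time `ℓ` solves, up to and including the first time it is in `A`,
the reflection equation
`p t = x + σ (w t) - ∫₀ᵗ N(p s) dℓ(s)`
driven by the path `w`: it stays in the closure of `D`, and the continuous nondecreasing function
`ℓ` increases only while `p` is on the reflecting boundary `∂D \ A`. -/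
structure IsReflectedPath {d : ℕ} (D A : Set (EuclideanSpace ℝ (Fin d)))
    (σ : Matrix (Fin d) (Fin d) ℝ) (x : EuclideanSpace ℝ (Fin d))
    (w p : ℝ≥0 → EuclideanSpace ℝ (Fin d)) (ℓ : StieltjesFunction ℝ≥0) : Prop where
  continuous_path : Continuous p
  continuous_localTime : Continuous ℓ
  localTime_zero : ℓ 0 = 0
  start : p 0 = x
  mem_closure : ∀ t, (∀ s < t, p s ∉ A) → p t ∈ closure D
  localTime_support : ∀ t, (∀ s < t, p s ∉ A) →
    ℓ.measure {s | s ≤ t ∧ p s ∉ frontier D \ A} = 0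
  equation : ∀ t, (∀ s < t, p s ∉ A) →
    p t = x + Matrix.toEuclideanCLM (𝕜 := ℝ) σ (w t)
      - ∫ s in Ioc 0 t, outwardNormal D (p s) ∂ℓ.measure

/-- `(X, W, ξ)` is, on the probability space `(S, P)`, the diffusion
`dX = σ dW - N(X) dξ`, `X 0 = x`, in `D`, normally reflected on `∂D \ A` with local time `ξ`, and
stopped at the absorbing boundary `A`. The noise is additive, so that the equation has a pathwise
meaning. Nothing is asked of `X` and `ξ` after the first exit time. -/
structure IsReflectedDiffusion {d : ℕ} {S : Type*} [MeasurableSpace S] (P : Measure S)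
    (D A : Set (EuclideanSpace ℝ (Fin d))) (σ : Matrix (Fin d) (Fin d) ℝ)
    (x : EuclideanSpace ℝ (Fin d)) (X W : ℝ≥0 → S → EuclideanSpace ℝ (Fin d))
    (ξ : ℝ≥0 → S → ℝ) : Prop where
  wiener : IsWienerProcess P W
  measurable : ∀ t, Measurable (X t)
  measurable_localTime : ∀ t, Measurable (ξ t)
  path : ∀ᵐ ω ∂P, ∃ ℓ : StieltjesFunction ℝ≥0, (∀ t, ℓ t = ξ t ω) ∧
    IsReflectedPath D A σ x (fun t => W t ω) (fun t => X t ω) ℓ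

end

/-! If `X'` solves the reflection equation in `Λ • D` with noise `W'`, then `t ↦ Λ⁻¹ • X' (Λ² t)`
solves it in `D` with noise `t ↦ Λ⁻¹ • W' (Λ² t)`, which is again a Wiener process, and exit times
are divided by `Λ²`. Since the two realisations are arbitrary and unrelated, it remains to see that
the exit time is one and the same measurable function `F` of the noise for every solution; equality
of the noise laws then gives equality of the expectations.

That the noise determines the exit time is pathwise uniqueness. A `C²` boundary has a local exterior
sphere property (`IsDefiningFunctionAt.eventually_inner_outwardNormal_le`), with a uniform constant
on compact parts of the reflecting boundary. Hence the squared distance of two solutions with the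
same noise obeys a Gronwall inequality in the sum of their local times, as long as both stay away
from `A` (`eq_of_staysAway`). A continuation argument removes the assumption on the second path
(`staysAway_of_staysAway`).

For measurability, only rational times and an integral-free form of the equation are kept, so that
noise, path and local time range over a standard Borel space in which solutions form a Borel set.
The noises whose solution avoids `A` up to `T`, and those whose solution does not, are two analytic
sets, disjoint by uniqueness; Lusin separation puts a Borel set between them
(`exists_measurableSet_staysAway`). The functional `F` is assembled from these Borel sets
(`exists_exitTime_functional`). -/

noncomputable section

/-! ### Geometry of the reflecting boundary. -/

section Geometry

variable {d : ℕ} {D A : Set (EuclideanSpace ℝ (Fin d))} {p : EuclideanSpace ℝ (Fin d)}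
  {ρ : EuclideanSpace ℝ (Fin d) → ℝ}

lemma norm_outwardNormal_le_one (D : Set (EuclideanSpace ℝ (Fin d)))
    (p : EuclideanSpace ℝ (Fin d)) : ‖outwardNormal D p‖ ≤ 1 := by
  unfold outwardNormal
  split_ifs with h
  · exact (norm_smul_inv_norm (𝕜 := ℝ) h.choose_spec.gradient_ne_zero).le
  · simp

lemma ContDiffAt.continuousAt_gradient (h : ContDiffAt ℝ 2 ρ p) :
    ContinuousAt (gradient ρ) p := by
  have h1 : ContinuousAt (fderiv ℝ ρ) p :=
    (h.fderiv_right (m := 1) (by norm_num)).continuousAt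
  exact (InnerProductSpace.toDual ℝ _).symm.continuous.continuousAt.comp h1

lemma IsDefiningFunctionAt.eventually_nonpos (h : IsDefiningFunctionAt D p ρ) :
    ∀ᶠ q in 𝓝 p, q ∈ closure D → ρ q ≤ 0 := by
  filter_upwards [h.mem_iff.eventually_nhds, h.contDiffAt.eventually (by norm_num)]
    with q hq hc hqD
  have hf : ∃ᶠ y in 𝓝 q, y ∈ D := mem_closure_iff_frequently.1 hqD
  have hf' : ∃ᶠ y in 𝓝 q, ρ y ≤ 0 := (hf.and_eventually hq).mono fun y hy => (hy.2.1 hy.1).le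
  by_contra! hpos
  exact hf' ((hc.continuousAt.eventually (lt_mem_nhds hpos)).mono fun y hy => not_le.2 hy)

/-- A boundary point `q` near `p` has `ρ q ≤ 0` as a limit of points of `D`, and `ρ q < 0` would put
it in the open set `D`. So one `ρ` computes the normal at all boundary points near `p`, which gives
its continuity there. -/
lemma IsDefiningFunctionAt.eventually (hD : IsOpen D) (h : IsDefiningFunctionAt D p ρ) :
    ∀ᶠ q in 𝓝 p, q ∈ frontier D → IsDefiningFunctionAt D q ρ := by
  filter_upwards [h.mem_iff.eventually_nhds, h.contDiffAt.eventually (by norm_num),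
    h.eventually_nonpos, h.contDiffAt.continuousAt_gradient.eventually_ne h.gradient_ne_zero]
    with q hq hc hn hg hqD
  rw [hD.frontier_eq] at hqD
  refine ⟨hc, le_antisymm (hn hqD.1) ?_, hg, hq⟩
  exact not_lt.1 fun hlt => hqD.2 (hq.self_of_nhds.2 hlt)

lemma continuousOn_outwardNormal (hD : IsOpen D)
    (hR : ∀ p ∈ frontier D \ A, ∃ ρ, IsDefiningFunctionAt D p ρ) :
    ContinuousOn (outwardNormal D) (frontier D \ A) := by
  intro q hq
  obtain ⟨ρ, hρ⟩ := hR q hq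
  have hg := hρ.contDiffAt.continuousAt_gradient
  have hc : ContinuousAt (fun y => ‖gradient ρ y‖⁻¹ • gradient ρ y) q :=
    (hg.norm.inv₀ (norm_ne_zero_iff.2 hρ.gradient_ne_zero)).smul hg
  refine hc.continuousWithinAt.congr_of_eventuallyEq ?_ (outwardNormal_eq hρ)
  filter_upwards [mem_nhdsWithin_of_mem_nhds (hρ.eventually hD), self_mem_nhdsWithin]
    with y hy hyR
  exact outwardNormal_eq (hy hyR.1)

/-- A `C²` boundary satisfies a uniform exterior sphere condition locally. -/
lemma IsDefiningFunctionAt.eventually_inner_outwardNormal_le (hD : IsOpen D)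
    (h : IsDefiningFunctionAt D p ρ) :
    ∃ C : ℝ, ∀ᶠ q in 𝓝 p, q ∈ frontier D → ∀ y ∈ closure D,
      inner ℝ (y - q) (outwardNormal D q) ≤ C * ‖y - q‖ ^ 2 := by
  obtain ⟨K, t, ht, hK⟩ :=
    (h.contDiffAt.fderiv_right (m := 1) (by norm_num)).exists_lipschitzOnWith
  have hm : 0 < ‖gradient ρ p‖ / 2 := half_pos (norm_pos_iff.2 h.gradient_ne_zero)
  have hmlt : ‖gradient ρ p‖ / 2 < ‖gradient ρ p‖ := by linarith
  obtain ⟨r, hr, hball⟩ := Metric.eventually_nhds_iff_ball.1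
    (((Filter.eventually_mem_set.2 ht).and (h.contDiffAt.eventually (by norm_num))).and
      ((h.eventually_nonpos.and (h.eventually hD)).and
      (h.contDiffAt.continuousAt_gradient.norm.eventually (lt_mem_nhds hmlt))))
  set m := ‖gradient ρ p‖ / 2
  -- `K / m` serves `y` within `r / 2` of `q`, by Taylor's formula and `‖gradient ρ q‖ > m`; `2 / r`
  -- serves the remaining `y`, where Cauchy–Schwarz suffices.
  refine ⟨K / m + 2 / r, ?_⟩
  filter_upwards [Metric.ball_mem_nhds p (half_pos hr)] with q hq hqD y hy
  have hqr : q ∈ Metric.ball p r := Metric.ball_subset_ball (by linarith) hq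
  have hKm : 0 ≤ K / m * ‖y - q‖ ^ 2 := by positivity
  have h2r : 0 ≤ 2 / r * ‖y - q‖ ^ 2 := by positivity
  rw [add_mul]
  obtain hlt | hge := lt_or_ge ‖y - q‖ (r / 2)
  · have hseg : segment ℝ q y ⊆ Metric.ball p r := by
      refine (convex_ball p r).segment_subset hqr ?_
      have := dist_triangle y q p
      rw [Metric.mem_ball] at hq ⊢
      rw [dist_eq_norm y q] at this
      linarith
    have htaylor : ‖ρ y - ρ q - fderiv ℝ ρ q (y - q)‖ ≤ K * ‖y - q‖ * ‖y - q‖ := by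
      refine (convex_segment q y).norm_image_sub_le_of_norm_hasFDerivWithin_le'
        (f' := fderiv ℝ ρ) (fun z hz => ?_) (fun z hz => ?_)
        (left_mem_segment ℝ q y) (right_mem_segment ℝ q y)
      · exact ((hball z (hseg hz)).1.2.differentiableAt
          (by norm_num)).hasFDerivAt.hasFDerivWithinAt
      · refine (hK.norm_sub_le (hball z (hseg hz)).1.1 (hball q hqr).1.1).trans ?_
        gcongr
        obtain ⟨a, b, ha, hb, hab, rfl⟩ := hz
        have : a • q + b • y - q = b • (y - q) := by
          rw [← eq_sub_iff_add_eq] at hab; subst hab; module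
        rw [this, norm_smul, Real.norm_of_nonneg hb]
        exact mul_le_of_le_one_left (norm_nonneg _) (by linarith)
    have hdef := (hball q hqr).2.1.2 hqD
    have hyρ := (hball y (hseg (right_mem_segment ℝ q y))).2.1.1 hy
    have hmq := (hball q hqr).2.2
    rw [hdef.eq_zero, sub_zero] at htaylor
    have h1 : fderiv ℝ ρ q (y - q) ≤ K * ‖y - q‖ ^ 2 := by
      have := (abs_le.1 htaylor).1
      nlinarith
    have h2 : inner ℝ (y - q) (gradient ρ q) = fderiv ℝ ρ q (y - q) := by
      rw [real_inner_comm]; simp [gradient]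
    rw [outwardNormal_eq hdef, real_inner_smul_right, h2]
    have h3 : ‖gradient ρ q‖⁻¹ * fderiv ℝ ρ q (y - q) ≤ m⁻¹ * (K * ‖y - q‖ ^ 2) := by
      refine (mul_le_mul_of_nonneg_left h1 (by positivity)).trans ?_
      gcongr
    calc _ ≤ m⁻¹ * (K * ‖y - q‖ ^ 2) := h3
      _ = K / m * ‖y - q‖ ^ 2 := by ring
      _ ≤ _ := by linarith
  · have h1 : inner ℝ (y - q) (outwardNormal D q) ≤ ‖y - q‖ := by
      refine (real_inner_le_norm _ _).trans ?_
      exact mul_le_of_le_one_right (norm_nonneg _) (norm_outwardNormal_le_one D q)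
    have h2 : ‖y - q‖ ≤ 2 / r * ‖y - q‖ ^ 2 := by
      have : 2 / r * ‖y - q‖ ^ 2 = ‖y - q‖ * (‖y - q‖ / (r / 2)) := by field_simp
      rw [this]
      exact le_mul_of_one_le_right (norm_nonneg _) ((one_le_div (half_pos hr)).2 hge)
    linarith

/-- The constant may blow up on approach to `A`, so uniformity is available only on compact parts of
the reflecting boundary. This is why later estimates stop before `A` is reached. -/
lemma IsCompact.exists_inner_outwardNormal_le (hD : IsOpen D)
    (hR : ∀ p ∈ frontier D \ A, ∃ ρ, IsDefiningFunctionAt D p ρ)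
    {K : Set (EuclideanSpace ℝ (Fin d))} (hK : IsCompact K) (hKR : K ⊆ frontier D \ A) :
    ∃ C : ℝ, 0 ≤ C ∧ ∀ q ∈ K, ∀ y ∈ closure D,
      inner ℝ (y - q) (outwardNormal D q) ≤ C * ‖y - q‖ ^ 2 := by
  refine hK.induction_on (p := fun K => ∃ C : ℝ, 0 ≤ C ∧ ∀ q ∈ K, ∀ y ∈ closure D,
      inner ℝ (y - q) (outwardNormal D q) ≤ C * ‖y - q‖ ^ 2) ⟨0, le_rfl, by simp⟩ ?_ ?_ ?_
  · rintro s t hst ⟨C, hC, h⟩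
    exact ⟨C, hC, fun q hq => h q (hst hq)⟩
  · rintro s t ⟨C, hC, h⟩ ⟨C', hC', h'⟩
    refine ⟨max C C', le_max_of_le_left hC, ?_⟩
    rintro q (hq | hq) y hy
    · exact (h q hq y hy).trans (by gcongr; exact le_max_left _ _)
    · exact (h' q hq y hy).trans (by gcongr; exact le_max_right _ _)
  · intro q hq
    obtain ⟨ρ, hρ⟩ := hR q (hKR hq)
    obtain ⟨C, hC⟩ := hρ.eventually_inner_outwardNormal_le hD
    refine ⟨_, Filter.inter_mem (mem_nhdsWithin_of_mem_nhds hC) self_mem_nhdsWithin,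
      max C 0, le_max_right _ _, fun y hy z hz => (hy.1 (hKR hy.2).1 z hz).trans ?_⟩
    gcongr
    exact le_max_left _ _

lemma frontier_smul_of_pos {Λ : ℝ} (hΛ : 0 < Λ) (D : Set (EuclideanSpace ℝ (Fin d))) :
    frontier (Λ • D) = Λ • frontier D := by
  rw [frontier, frontier, closure_smul₀ Λ, interior_smul₀ hΛ.ne', smul_set_sdiff₀ hΛ.ne']

lemma IsDefiningFunctionAt.smul {Λ : ℝ} (hΛ : 0 < Λ) (h : IsDefiningFunctionAt D p ρ) :
    IsDefiningFunctionAt (Λ • D) (Λ • p) (fun y => ρ (Λ⁻¹ • y)) where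
  contDiffAt := by
    have h1 : ContDiffAt ℝ 2 ρ (Λ⁻¹ • Λ • p) := by rw [inv_smul_smul₀ hΛ.ne']; exact h.contDiffAt
    exact h1.comp (Λ • p) (contDiff_const_smul Λ⁻¹).contDiffAt
  eq_zero := by rw [inv_smul_smul₀ hΛ.ne']; exact h.eq_zero
  gradient_ne_zero := by
    have h0 := h.gradient_ne_zero
    simp only [gradient, ne_eq, EmbeddingLike.map_eq_zero_iff] at h0 ⊢
    rw [fderiv_comp_smul, inv_smul_smul₀ hΛ.ne']
    simpa [hΛ.ne'] using h0
  mem_iff := by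
    have hc : ContinuousAt (fun y : EuclideanSpace ℝ (Fin d) => Λ⁻¹ • y) (Λ • p) :=
      (continuous_const_smul _).continuousAt
    have h1 : ∀ᶠ y in 𝓝 (Λ⁻¹ • Λ • p), (y ∈ D ↔ ρ y < 0) := by
      rw [inv_smul_smul₀ hΛ.ne']; exact h.mem_iff
    filter_upwards [hc.eventually h1] with y hy
    rw [mem_smul_set_iff_inv_smul_mem₀ hΛ.ne', hy]

lemma exists_isDefiningFunctionAt_smul {Λ : ℝ} (hΛ : 0 < Λ)
    (hR : ∀ p ∈ frontier D \ A, ∃ ρ, IsDefiningFunctionAt D p ρ) :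
    ∀ p ∈ frontier (Λ • D) \ Λ • A, ∃ ρ, IsDefiningFunctionAt (Λ • D) p ρ := by
  rw [frontier_smul_of_pos hΛ, ← smul_set_sdiff₀ hΛ.ne']
  rintro _ ⟨p, hp, rfl⟩
  obtain ⟨ρ, hρ⟩ := hR p hp
  exact ⟨_, hρ.smul hΛ⟩

end Geometry

/-! ### Estimates on the boundary push of a reflected path. -/

section PathEstimate

variable {d : ℕ} {D A : Set (EuclideanSpace ℝ (Fin d))} {σ : Matrix (Fin d) (Fin d) ℝ}
  {x : EuclideanSpace ℝ (Fin d)} {w p : ℝ≥0 → EuclideanSpace ℝ (Fin d)}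
  {ℓ : StieltjesFunction ℝ≥0}

/-- The increment over `[s, t]` of the noise minus that of the path: for a reflected path, this
is the increment of the boundary push. -/
def pushIncrement {T : Type*} (σ : Matrix (Fin d) (Fin d) ℝ)
    (w p : T → EuclideanSpace ℝ (Fin d)) (s t : T) : EuclideanSpace ℝ (Fin d) :=
  Matrix.toEuclideanCLM (𝕜 := ℝ) σ (w t - w s) - (p t - p s)

lemma IsReflectedPath.ae_mem_frontier (hp : IsReflectedPath D A σ x w p ℓ) {t : ℝ≥0}
    (ht : ∀ s ≤ t, p s ∉ A) (s : ℝ≥0) :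
    ∀ᵐ r ∂ℓ.measure.restrict (Ioc s t), p r ∈ frontier D \ A := by
  rw [ae_restrict_iff' measurableSet_Ioc, ae_iff]
  refine measure_mono_null (fun r hr => ?_) (hp.localTime_support t fun s hs => ht s hs.le)
  simp only [mem_ofPred_eq, Classical.not_imp] at hr ⊢
  exact ⟨hr.1.2, hr.2⟩

/-- The normal is continuous only along the reflecting boundary, but `ℓ.measure` sees no other times
before `A` is hit; there the normal is measurable and bounded by `1`. -/
lemma IsReflectedPath.integrableOn (hD : IsOpen D) (hA : IsClosed A)
    (hR : ∀ p ∈ frontier D \ A, ∃ ρ, IsDefiningFunctionAt D p ρ)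
    (hp : IsReflectedPath D A σ x w p ℓ) {t : ℝ≥0} (ht : ∀ s ≤ t, p s ∉ A) (s : ℝ≥0) :
    IntegrableOn (fun r => outwardNormal D (p r)) (Ioc s t) ℓ.measure := by
  have hae : ∀ᵐ r ∂ℓ.measure.restrict (Ioc s t), r ∈ p ⁻¹' (frontier D \ A) :=
    hp.ae_mem_frontier ht s
  have hmeas : MeasurableSet (p ⁻¹' (frontier D \ A)) :=
    (isClosed_frontier.measurableSet.diff hA.measurableSet).preimage
      hp.continuous_path.measurable
  have hcont : ContinuousOn (fun r => outwardNormal D (p r)) (p ⁻¹' (frontier D \ A)) :=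
    (continuousOn_outwardNormal hD hR).comp hp.continuous_path.continuousOn fun _ h => h
  have hsm : AEStronglyMeasurable (fun r => outwardNormal D (p r))
      (ℓ.measure.restrict (Ioc s t)) := by
    have h1 := hcont.aestronglyMeasurable (μ := ℓ.measure.restrict (Ioc s t)) hmeas
    rwa [Measure.restrict_eq_self_of_ae_mem hae] at h1
  have : IsFiniteMeasure (ℓ.measure.restrict (Ioc s t)) := ⟨by
    rw [Measure.restrict_apply_univ, StieltjesFunction.measure_Ioc]
    exact ENNReal.ofReal_lt_top⟩
  exact Integrable.of_bound hsm 1 (.of_forall fun r => norm_outwardNormal_le_one D (p r))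

lemma IsReflectedPath.pushIncrement_eq (hD : IsOpen D) (hA : IsClosed A)
    (hR : ∀ p ∈ frontier D \ A, ∃ ρ, IsDefiningFunctionAt D p ρ)
    (hp : IsReflectedPath D A σ x w p ℓ) {s t : ℝ≥0} (hst : s ≤ t) (ht : ∀ s ≤ t, p s ∉ A) :
    pushIncrement σ w p s t = ∫ r in Ioc s t, outwardNormal D (p r) ∂ℓ.measure := by
  have hs : ∀ r ≤ s, p r ∉ A := fun r hr => ht r (hr.trans hst)
  have h1 := setIntegral_union (μ := ℓ.measure) (f := fun r => outwardNormal D (p r))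
    (s := Ioc 0 s) (t := Ioc s t) (Ioc_disjoint_Ioc_of_le le_rfl) measurableSet_Ioc
    (hp.integrableOn hD hA hR hs 0) (hp.integrableOn hD hA hR ht s)
  rw [Ioc_union_Ioc_eq_Ioc zero_le hst] at h1
  rw [pushIncrement, hp.equation t fun r hr => ht r hr.le,
    hp.equation s fun r hr => hs r hr.le, h1, map_sub]
  abel

/-- Integral-free consequences of the reflection equation: the push is dominated by the local
time, and it is almost an outward normal vector. -/
lemma IsReflectedPath.exists_estimate (hD : IsOpen D) (hA : IsClosed A)
    (hR : ∀ p ∈ frontier D \ A, ∃ ρ, IsDefiningFunctionAt D p ρ)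
    (hp : IsReflectedPath D A σ x w p ℓ) {S : ℝ≥0} (hS : ∀ s ≤ S, p s ∉ A) :
    ∃ C : ℝ, 0 ≤ C ∧ ∀ ε > 0, ∃ δ > 0, ∀ s t : ℝ≥0, s ≤ t → t ≤ S → (t : ℝ) ≤ s + δ →
      ‖pushIncrement σ w p s t‖ ≤ ℓ t - ℓ s ∧ ∀ y ∈ closure D,
        inner ℝ (y - p s) (pushIncrement σ w p s t) ≤ (C * ‖y - p s‖ ^ 2 + ε) * (ℓ t - ℓ s) := by
  have hK : IsCompact (p '' Icc 0 S ∩ frontier D) :=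
    (isCompact_Icc.image hp.continuous_path).inter_right isClosed_frontier
  obtain ⟨C, hC, hbound⟩ := hK.exists_inner_outwardNormal_le (A := A) hD hR (by
    rintro _ ⟨⟨s, hs, rfl⟩, h⟩
    exact ⟨h, hS s hs.2⟩)
  -- The factor `2` comes from `‖y - p r‖² ≤ 2 ‖y - p s‖² + 2 η²`, where `η` bounds the oscillation
  -- of `p`. The leftover `2 C η² + η` is at most `ε` by the choice of `η ≤ 1`.
  refine ⟨2 * C, by positivity, fun ε hε => ?_⟩
  obtain ⟨η, hη, hη1, hηε⟩ : ∃ η : ℝ, 0 < η ∧ η ≤ 1 ∧ (2 * C + 1) * η ≤ ε := by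
    refine ⟨min 1 (ε / (2 * C + 1)), by positivity, min_le_left _ _, ?_⟩
    calc _ ≤ (2 * C + 1) * (ε / (2 * C + 1)) := by gcongr; exact min_le_right _ _
      _ = ε := by field_simp
  have huc : UniformContinuousOn p (Icc 0 S) :=
    isCompact_Icc.uniformContinuousOn_of_continuous hp.continuous_path.continuousOn
  obtain ⟨δ, hδ, hpδ⟩ := Metric.uniformContinuousOn_iff_le.1 huc η hη
  refine ⟨δ, hδ, fun s t hst htS hδst => ?_⟩
  have ht : ∀ r ≤ t, p r ∉ A := fun r hr => hS r (hr.trans htS)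
  have hmass : ℓ.measure.real (Ioc s t) = ℓ t - ℓ s := by
    rw [measureReal_def, StieltjesFunction.measure_Ioc,
      ENNReal.toReal_ofReal (sub_nonneg.2 (ℓ.mono hst))]
  have hfin : ℓ.measure (Ioc s t) < ⊤ := by
    rw [StieltjesFunction.measure_Ioc]; exact ENNReal.ofReal_lt_top
  rw [hp.pushIncrement_eq hD hA hR hst ht, ← hmass]
  refine ⟨?_, fun y hy => ?_⟩
  · simpa using norm_setIntegral_le_of_norm_le_const (C := 1) hfin
      fun r _ => norm_outwardNormal_le_one D (p r)
  · have hint := hp.integrableOn hD hA hR ht s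
    rw [← integral_inner hint]
    -- Write `y - p s = (y - p r) + (p r - p s)`: the exterior sphere bound at the boundary point `p
    -- r` controls the first term, the oscillation of `p` the second.
    have hle : ∀ᵐ r ∂ℓ.measure.restrict (Ioc s t),
        inner ℝ (y - p s) (outwardNormal D (p r)) ≤ 2 * C * ‖y - p s‖ ^ 2 + ε := by
      filter_upwards [hp.ae_mem_frontier ht s, ae_restrict_mem measurableSet_Ioc] with r hr hrst
      have hd : ‖p r - p s‖ ≤ η := by
        rw [← dist_eq_norm]
        refine hpδ r ⟨zero_le, hrst.2.trans htS⟩ s ⟨zero_le, hst.trans htS⟩ ?_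
        have h1 : (s : ℝ) ≤ r := hrst.1.le
        have h2 : (r : ℝ) ≤ t := hrst.2
        rw [NNReal.dist_eq, abs_of_nonneg (sub_nonneg.2 h1)]
        linarith
      have h1 := hbound (p r) ⟨⟨r, ⟨zero_le, hrst.2.trans htS⟩, rfl⟩, hr.1⟩ y hy
      have h2 : inner ℝ (p r - p s) (outwardNormal D (p r)) ≤ η :=
        (real_inner_le_norm _ _).trans <| (mul_le_of_le_one_right (norm_nonneg _)
          (norm_outwardNormal_le_one D (p r))).trans hd
      have h3 : ‖y - p r‖ ^ 2 ≤ 2 * ‖y - p s‖ ^ 2 + 2 * η ^ 2 := by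
        have h4 : ‖y - p r‖ ≤ ‖y - p s‖ + η := by
          calc ‖y - p r‖ = ‖(y - p s) - (p r - p s)‖ := by congr 1; abel
            _ ≤ _ := (norm_sub_le _ _).trans (by gcongr)
        nlinarith [norm_nonneg (y - p r), sq_nonneg (‖y - p s‖ - η), norm_nonneg (y - p s)]
      have h5 : y - p s = (y - p r) + (p r - p s) := by abel
      have h6 : C * ‖y - p r‖ ^ 2 ≤ C * (2 * ‖y - p s‖ ^ 2 + 2 * η ^ 2) := by gcongr
      have h7 : C * η ^ 2 ≤ C * η := by gcongr; nlinarith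
      calc inner ℝ (y - p s) (outwardNormal D (p r))
          = inner ℝ (y - p r) (outwardNormal D (p r))
            + inner ℝ (p r - p s) (outwardNormal D (p r)) := by rw [← inner_add_left, ← h5]
        _ ≤ _ := by linarith
    have : IsFiniteMeasure (ℓ.measure.restrict (Ioc s t)) :=
      ⟨by rwa [Measure.restrict_apply_univ]⟩
    calc _ ≤ ∫ _ in Ioc s t, (2 * C * ‖y - p s‖ ^ 2 + ε) ∂ℓ.measure :=
          integral_mono_ae (hint.const_inner _) (integrable_const _) hle
      _ = _ := by rw [setIntegral_const, smul_eq_mul, mul_comm]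

end PathEstimate

/-! ### Paths at rational times: uniqueness and measurability. -/

section RationalPath

variable {d : ℕ} {D A : Set (EuclideanSpace ℝ (Fin d))} {σ : Matrix (Fin d) (Fin d) ℝ}
  {x : EuclideanSpace ℝ (Fin d)}

/-- The path `p`, known at rational times, keeps a positive distance to `A` on `[0, T]`. -/
def StaysAway (A : Set (EuclideanSpace ℝ (Fin d))) (p : ℚ≥0 → EuclideanSpace ℝ (Fin d))
    (T : ℚ≥0) : Prop :=
  ∃ n : ℕ, ∀ r ≤ T, 1 / ((n : ℝ) + 1) ≤ Metric.infDist (p r) A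

/-- An integral-free form, at rational times, of the reflection equation. -/
structure IsRationalReflectedPath (D A : Set (EuclideanSpace ℝ (Fin d)))
    (σ : Matrix (Fin d) (Fin d) ℝ) (x : EuclideanSpace ℝ (Fin d))
    (w p : ℚ≥0 → EuclideanSpace ℝ (Fin d)) (ℓ : ℚ≥0 → ℝ) : Prop where
  start : p 0 = x
  uniform : ∀ (T : ℚ≥0) (m : ℕ), ∃ N : ℕ, ∀ s t, s ≤ t → t ≤ T → t ≤ s + 1 / ((N : ℚ≥0) + 1) →
    ‖p t - p s‖ ≤ 1 / ((m : ℝ) + 1)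
  estimate : ∀ T, StaysAway A p T → ∃ C : ℕ, ∀ m : ℕ, ∃ N : ℕ, ∀ s t, s ≤ t → t ≤ T →
    t ≤ s + 1 / ((N : ℚ≥0) + 1) →
    p s ∈ closure D ∧ ‖pushIncrement σ w p s t‖ ≤ ℓ t - ℓ s ∧ ∀ y ∈ closure D,
      inner ℝ (y - p s) (pushIncrement σ w p s t) ≤
        (C * ‖y - p s‖ ^ 2 + 1 / ((m : ℝ) + 1)) * (ℓ t - ℓ s)

lemma StaysAway.mono {p : ℚ≥0 → EuclideanSpace ℝ (Fin d)} {S T : ℚ≥0} (h : StaysAway A p T)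
    (hST : S ≤ T) : StaysAway A p S := by
  obtain ⟨n, hn⟩ := h
  exact ⟨n, fun r hr => hn r (hr.trans hST)⟩

/-- Discrete Gronwall inequality, from `1 + a ≤ exp a`. Adding `ε` to `u` absorbs the error of each
step into a purely multiplicative bound. -/
lemma add_le_mul_exp_of_step {u L : ℕ → ℝ} {K ε : ℝ} {n : ℕ} (hε : 0 ≤ ε) (hu : ∀ i, 0 ≤ u i)
    (h : ∀ i < n, u (i + 1) + ε ≤ (u i + ε) * (1 + K * (L (i + 1) - L i))) :
    u n + ε ≤ (u 0 + ε) * Real.exp (K * (L n - L 0)) := by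
  induction n with
  | zero => simp
  | succ n ih =>
    have h1 := ih fun i hi => h i (hi.trans n.lt_succ_self)
    calc _ ≤ (u n + ε) * (1 + K * (L (n + 1) - L n)) := h n n.lt_succ_self
      _ ≤ (u n + ε) * Real.exp (K * (L (n + 1) - L n)) := by
          have := hu n
          gcongr
          linarith [Real.add_one_le_exp (K * (L (n + 1) - L n))]
      _ ≤ (u 0 + ε) * Real.exp (K * (L n - L 0)) * Real.exp (K * (L (n + 1) - L n)) := by gcongr
      _ = _ := by rw [mul_assoc, ← Real.exp_add]; ring_nf

namespace IsRationalReflectedPath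

variable {w p p' : ℚ≥0 → EuclideanSpace ℝ (Fin d)} {ℓ ℓ' : ℚ≥0 → ℝ} {T : ℚ≥0}

/-- One step of the comparison of two reflected paths driven by the same noise. -/
lemma _root_.norm_sq_sub_step {a b a' b' k k' : EuclideanSpace ℝ (Fin d)} {C ε Δ Δ' : ℝ}
    (hC : 0 ≤ C) (hε : 0 ≤ ε) (hk : b - a - (b' - a') = k' - k)
    (hΔ : ‖k‖ ≤ Δ) (hΔ' : ‖k'‖ ≤ Δ') (h : ‖b - a‖ ≤ ε) (h' : ‖b' - a'‖ ≤ ε)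
    (hi : inner ℝ (a' - a) k ≤ (C * ‖a' - a‖ ^ 2 + ε) * Δ)
    (hi' : inner ℝ (a - a') k' ≤ (C * ‖a - a'‖ ^ 2 + ε) * Δ') :
    ‖b - b'‖ ^ 2 + ε ≤ (‖a - a'‖ ^ 2 + ε) * (1 + (2 * C + 4) * (Δ + Δ')) := by
  have h1 : b - b' = (a - a') + (k' - k) := by rw [← hk]; abel
  have h2 : inner ℝ (a - a') (k' - k) = inner ℝ (a' - a) k + inner ℝ (a - a') k' := by
    rw [inner_sub_right, ← neg_sub a a', inner_neg_left]; ring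
  have h3 : ‖k' - k‖ ≤ Δ + Δ' := (norm_sub_le _ _).trans (by linarith)
  -- The noise cancels, so `k' - k` is small like the path increments as well as dominated by the
  -- local times. Multiplying the two bounds makes the quadratic term `ε` times a local time
  -- increment.
  have h4 : ‖k' - k‖ ≤ 2 * ε := by rw [← hk]; exact (norm_sub_le _ _).trans (by linarith)
  have h5 : ‖k' - k‖ ^ 2 ≤ 2 * ε * (Δ + Δ') := by
    rw [sq]; exact mul_le_mul h4 h3 (norm_nonneg _) (by positivity)
  rw [norm_sub_rev a' a] at hi
  have hΔ0 : 0 ≤ Δ + Δ' := (norm_nonneg _).trans h3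
  have h6 : ‖b - b'‖ ^ 2 =
      ‖a - a'‖ ^ 2 + 2 * inner ℝ (a - a') (k' - k) + ‖k' - k‖ ^ 2 := by
    rw [h1, norm_add_sq_real]
  have h7 : 0 ≤ 4 * ‖a - a'‖ ^ 2 * (Δ + Δ') := by positivity
  have h8 : 0 ≤ 2 * C * ε * (Δ + Δ') := by positivity
  rw [h6, h2]
  nlinarith

/-- Two reflected paths driven by the same noise agree as long as both stay away from `A`. -/
lemma eq_of_staysAway (hp : IsRationalReflectedPath D A σ x w p ℓ)
    (hp' : IsRationalReflectedPath D A σ x w p' ℓ') (hT : StaysAway A p T)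
    (hT' : StaysAway A p' T) {t : ℚ≥0} (ht : t ≤ T) : p t = p' t := by
  obtain ⟨C₁, hC₁⟩ := hp.estimate T hT
  obtain ⟨C₂, hC₂⟩ := hp'.estimate T hT'
  set C : ℝ := max (C₁ : ℝ) C₂
  have hC0 : 0 ≤ C := le_max_of_le_left (Nat.cast_nonneg _)
  -- The Gronwall factor involves only total local times, not the mesh, so the error `1 / (m + 1)`
  -- can be sent to `0` afterwards.
  set c : ℝ := Real.exp ((2 * C + 4) * (ℓ t + ℓ' t - (ℓ 0 + ℓ' 0)))
  have key : ∀ m : ℕ, ‖p t - p' t‖ ^ 2 ≤ c * (1 / ((m : ℝ) + 1)) := by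
    intro m
    obtain ⟨N₁, h₁⟩ := hC₁ m
    obtain ⟨N₂, h₂⟩ := hC₂ m
    obtain ⟨N₃, h₃⟩ := hp.uniform T m
    obtain ⟨N₄, h₄⟩ := hp'.uniform T m
    set N := max (max N₁ N₂) (max N₃ N₄)
    have hN : ∀ k ≤ N, (1 : ℚ≥0) / ((N : ℚ≥0) + 1) ≤ 1 / ((k : ℚ≥0) + 1) := fun k hk => by
      gcongr
    have hN₁ := hN N₁ (by simp [N])
    have hN₂ := hN N₂ (by simp [N])
    have hN₃ := hN N₃ (by simp [N])
    have hN₄ := hN N₄ (by simp [N])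
    -- Makes the mesh `t / M` at most `1 / (N + 1)`; the `+ 1` after the ceiling keeps `M` positive
    -- when `t = 0`.
    set M : ℕ := (⌈t⌉₊ + 1) * (N + 1) with hM
    have hM0 : (0 : ℚ≥0) < M := by rw [hM]; positivity
    set τ : ℕ → ℚ≥0 := fun i => i * (t / M) with hτ
    have hstep : t / M ≤ 1 / ((N : ℚ≥0) + 1) := by
      rw [hM, div_le_div_iff₀ (by positivity) (by positivity)]
      push_cast
      have := Nat.le_ceil t
      rw [one_mul]
      gcongr
      exact this.trans le_self_add
    have hτs : ∀ i, τ (i + 1) = τ i + t / M := fun i => by simp only [hτ]; push_cast; ring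
    have hτM : τ M = t := by simp only [hτ]; field_simp
    have hτ0 : τ 0 = 0 := by simp [hτ]
    have hτle : ∀ i ≤ M, τ i ≤ t := fun i hi => by
      rw [← hτM]; simp only [hτ]; gcongr
    have hε : (0 : ℝ) ≤ 1 / ((m : ℝ) + 1) := by positivity
    have hg := add_le_mul_exp_of_step (u := fun i => ‖p (τ i) - p' (τ i)‖ ^ 2)
      (L := fun i => ℓ (τ i) + ℓ' (τ i)) (K := 2 * C + 4) (n := M) hε
      (fun i => by positivity) (fun i hi => by
        have hs : τ i ≤ τ (i + 1) := by rw [hτs]; exact le_self_add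
        have hsT : τ (i + 1) ≤ T := (hτle _ hi).trans ht
        have hsn : ∀ k : ℕ, (1 : ℚ≥0) / ((N : ℚ≥0) + 1) ≤ 1 / ((k : ℚ≥0) + 1) →
            τ (i + 1) ≤ τ i + 1 / ((k : ℚ≥0) + 1) := fun k hk => by
          rw [hτs]; exact add_le_add le_rfl (hstep.trans hk)
        obtain ⟨hm₁, hk₁, hy₁⟩ := h₁ _ _ hs hsT (hsn _ hN₁)
        obtain ⟨hm₂, hk₂, hy₂⟩ := h₂ _ _ hs hsT (hsn _ hN₂)
        have := norm_sq_sub_step hC0 hε (by simp only [pushIncrement]; abel) hk₁ hk₂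
          (h₃ _ _ hs hsT (hsn _ hN₃)) (h₄ _ _ hs hsT (hsn _ hN₄))
          ((hy₁ _ hm₂).trans (by
            have := (norm_nonneg _).trans hk₁
            gcongr; exact le_max_left _ _))
          ((hy₂ _ hm₁).trans (by
            have := (norm_nonneg _).trans hk₂
            gcongr; exact le_max_right _ _))
        convert this using 3
        ring)
    simp only [hτM, hτ0, hp.start, hp'.start, sub_self, norm_zero] at hg
    simp only [c]
    linarith
  have hlim : Filter.Tendsto (fun m : ℕ => c * (1 / ((m : ℝ) + 1))) Filter.atTop (𝓝 (c * 0)) :=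
    tendsto_one_div_add_atTop_nhds_zero_nat.const_mul c
  rw [mul_zero] at hlim
  have h0 : ‖p t - p' t‖ ^ 2 ≤ 0 := ge_of_tendsto' hlim key
  have h1 : ‖p t - p' t‖ = 0 := by nlinarith [norm_nonneg (p t - p' t)]
  exact sub_eq_zero.1 (norm_eq_zero.1 h1)

/-- Whether the absorbing set is approached before time `T` is determined by the noise. -/
lemma staysAway_of_staysAway (hp : IsRationalReflectedPath D A σ x w p ℓ)
    (hp' : IsRationalReflectedPath D A σ x w p' ℓ') (hT : StaysAway A p T) :
    StaysAway A p' T := by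
  obtain ⟨n, hn⟩ := id hT
  -- `1 / (2 n + 2)` is half of the distance `1 / (n + 1)` that `p` keeps from `A`.
  obtain ⟨N, hN⟩ := hp'.uniform T (2 * n + 1)
  set δ : ℚ≥0 := 1 / ((N : ℚ≥0) + 1) with hδ
  have hδ0 : 0 < δ := by positivity
  have hhalf : (1 : ℝ) / (((2 * n + 1 : ℕ) : ℝ) + 1) = 1 / ((n : ℝ) + 1) / 2 := by
    push_cast; field_simp; ring
  -- Continuation: up to `k δ` the paths agree, so `p'` inherits the full distance of `p`; during
  -- the next `δ` it loses at most half. Uniqueness then restores the full distance, so losses do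
  -- not accumulate.
  have hcover : ∀ k : ℕ, StaysAway A p' (min (k * δ) T) := by
    intro k
    induction k with
    | zero =>
      refine ⟨n, fun r hr => ?_⟩
      obtain rfl : r = 0 := by simpa using hr
      rw [hp'.start, ← hp.start]
      exact hn 0 zero_le
    | succ k ih =>
      have hfar : ∀ r ≤ min (k * δ) T, 1 / ((n : ℝ) + 1) ≤ Metric.infDist (p' r) A := by
        intro r hr
        rw [← hp.eq_of_staysAway hp' (hT.mono (min_le_right _ _)) ih hr]
        exact hn r (hr.trans (min_le_right _ _))
      refine ⟨2 * n + 1, fun r hr => ?_⟩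
      rw [hhalf]
      have hpos : (0 : ℝ) ≤ 1 / ((n : ℝ) + 1) := by positivity
      obtain hle | hlt := le_total r (min (k * δ) T)
      · exact (half_le_self hpos).trans (hfar r hle)
      · have hclose : ‖p' r - p' (min (k * δ) T)‖ ≤ 1 / ((n : ℝ) + 1) / 2 := by
          rw [← hhalf]
          refine hN _ _ hlt (hr.trans (min_le_right _ _)) (hr.trans ?_)
          rw [← min_add_add_right]
          refine min_le_min ?_ le_self_add
          push_cast
          rw [add_mul, one_mul]
        have h1 := hfar _ le_rfl
        have h2 := Metric.infDist_le_infDist_add_dist (s := A) (x := p' (min (k * δ) T))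
          (y := p' r)
        rw [dist_comm, dist_eq_norm] at h2
        linarith
  obtain ⟨k, hk⟩ := Archimedean.arch T hδ0
  have := hcover k
  rwa [min_eq_right (by simpa using hk)] at this

end IsRationalReflectedPath

/-- Rational-time reflected paths, as triples (noise, path, local time). -/
def rationalReflectedPaths (D A : Set (EuclideanSpace ℝ (Fin d))) (σ : Matrix (Fin d) (Fin d) ℝ)
    (x : EuclideanSpace ℝ (Fin d)) :
    Set ((ℚ≥0 → EuclideanSpace ℝ (Fin d)) × (ℚ≥0 → EuclideanSpace ℝ (Fin d)) × (ℚ≥0 → ℝ)) :=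
  {a | IsRationalReflectedPath D A σ x a.1 a.2.1 a.2.2}

lemma measurable_staysAway (A : Set (EuclideanSpace ℝ (Fin d))) (T : ℚ≥0) :
    Measurable fun p : ℚ≥0 → EuclideanSpace ℝ (Fin d) => StaysAway A p T := by
  refine Measurable.exists fun n => Measurable.forall fun r => measurable_const.imp ?_
  exact measurableSet_setOfPred.1 (measurableSet_le measurable_const
    ((Metric.continuous_infDist_pt A).measurable.comp (measurable_pi_apply r)))

/-- The quantifier over `y` is uncountable, so measurability comes from an intersection of closed
sets; the other quantifiers in `IsRationalReflectedPath` are countable. -/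
lemma isClosed_setOf_forall_inner_le (F : Set (EuclideanSpace ℝ (Fin d))) (C ε : ℝ) :
    IsClosed {a : EuclideanSpace ℝ (Fin d) × EuclideanSpace ℝ (Fin d) × ℝ |
      ∀ y ∈ F, inner ℝ (y - a.1) a.2.1 ≤ (C * ‖y - a.1‖ ^ 2 + ε) * a.2.2} := by
  simp only [ofPred_forall]
  exact isClosed_iInter fun y => isClosed_iInter fun _ => isClosed_le (by fun_prop) (by fun_prop)

lemma measurableSet_rationalReflectedPaths :
    MeasurableSet (rationalReflectedPaths D A σ x) := by
  have heval (t : ℚ≥0) : Measurable fun a : (ℚ≥0 → EuclideanSpace ℝ (Fin d)) ×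
      (ℚ≥0 → EuclideanSpace ℝ (Fin d)) × (ℚ≥0 → ℝ) => a.2.1 t := by fun_prop
  have hpush (s t : ℚ≥0) : Measurable fun a : (ℚ≥0 → EuclideanSpace ℝ (Fin d)) ×
      (ℚ≥0 → EuclideanSpace ℝ (Fin d)) × (ℚ≥0 → ℝ) => pushIncrement σ a.1 a.2.1 s t := by
    unfold pushIncrement
    exact ((ContinuousLinearMap.measurable _).comp (by fun_prop)).sub (by fun_prop)
  have hset : rationalReflectedPaths D A σ x =
      {a | a.2.1 0 = x} ∩ ({a | ∀ (T : ℚ≥0) (m : ℕ), ∃ N : ℕ, ∀ s t, s ≤ t → t ≤ T →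
        t ≤ s + 1 / ((N : ℚ≥0) + 1) → ‖a.2.1 t - a.2.1 s‖ ≤ 1 / ((m : ℝ) + 1)} ∩
      {a | ∀ T, StaysAway A a.2.1 T → ∃ C : ℕ, ∀ m : ℕ, ∃ N : ℕ, ∀ s t, s ≤ t → t ≤ T →
        t ≤ s + 1 / ((N : ℚ≥0) + 1) →
        a.2.1 s ∈ closure D ∧ ‖pushIncrement σ a.1 a.2.1 s t‖ ≤ a.2.2 t - a.2.2 s ∧
        ∀ y ∈ closure D, inner ℝ (y - a.2.1 s) (pushIncrement σ a.1 a.2.1 s t) ≤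
          (C * ‖y - a.2.1 s‖ ^ 2 + 1 / ((m : ℝ) + 1)) * (a.2.2 t - a.2.2 s)}) := by
    ext a
    exact ⟨fun h => ⟨h.1, h.2, h.3⟩, fun h => ⟨h.1, h.2.1, h.2.2⟩⟩
  rw [hset]
  refine (measurableSet_eq_fun (heval 0) measurable_const).inter (.inter ?_ ?_)
  · refine measurableSet_setOfPred.2 (.forall fun T => .forall fun m => .exists fun N =>
      .forall fun s => .forall fun t => measurable_const.imp (measurable_const.imp
      (measurable_const.imp (measurableSet_setOfPred.1 (measurableSet_le ?_ measurable_const)))))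
    exact ((heval t).sub (heval s)).norm
  · refine measurableSet_setOfPred.2 (.forall fun T => .imp
      ((measurable_staysAway A T).comp (measurable_fst.comp measurable_snd))
      (.exists fun C => .forall fun m => .exists fun N =>
      .forall fun s => .forall fun t => measurable_const.imp (measurable_const.imp
      (measurable_const.imp (.and ?_ (.and ?_ ?_))))))
    · exact measurableSet_setOfPred.1 (isClosed_closure.measurableSet.preimage (heval s))
    · exact measurableSet_setOfPred.1 (measurableSet_le (hpush s t).norm (by fun_prop))
    · exact measurableSet_setOfPred.1
        ((isClosed_setOf_forall_inner_le (closure D) C (1 / ((m : ℝ) + 1))).measurableSet.preimage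
          ((heval s).prodMk ((hpush s t).prodMk (by fun_prop))))

/-- There is a Borel set of noises that tells whether the reflected path stays away from `A`
on `[0, T]`. -/
lemma exists_measurableSet_staysAway (D A : Set (EuclideanSpace ℝ (Fin d)))
    (σ : Matrix (Fin d) (Fin d) ℝ) (x : EuclideanSpace ℝ (Fin d)) (T : ℚ≥0) :
    ∃ B : Set (ℚ≥0 → EuclideanSpace ℝ (Fin d)), MeasurableSet B ∧
      ∀ w p ℓ, IsRationalReflectedPath D A σ x w p ℓ → (w ∈ B ↔ StaysAway A p T) := by
  have hstay : MeasurableSet {a : (ℚ≥0 → EuclideanSpace ℝ (Fin d)) ×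
      (ℚ≥0 → EuclideanSpace ℝ (Fin d)) × (ℚ≥0 → ℝ) | StaysAway A a.2.1 T} :=
    measurableSet_setOfPred.2
      ((measurable_staysAway A T).comp (measurable_fst.comp measurable_snd))
  have hG := measurableSet_rationalReflectedPaths (D := D) (A := A) (σ := σ) (x := x)
  have : StandardBorelSpace (ℚ≥0 → EuclideanSpace ℝ (Fin d)) := inferInstance
  have : StandardBorelSpace ((ℚ≥0 → EuclideanSpace ℝ (Fin d)) × (ℚ≥0 → ℝ)) := inferInstance
  have h1 := (hG.inter hstay).analyticSet_image measurable_fst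
  have h2 := (hG.diff hstay).analyticSet_image measurable_fst
  -- Lusin separation; a common noise of the two projections would contradict
  -- `staysAway_of_staysAway`.
  obtain ⟨B, hB1, hB2, hB⟩ := h1.measurablySeparable h2 (by
    rw [Set.disjoint_left]
    rintro _ ⟨⟨w, p, ℓ⟩, ⟨hp, hT⟩, rfl⟩ ⟨⟨w', p', ℓ'⟩, ⟨hp', hT'⟩, h⟩
    obtain rfl : w' = w := h
    exact hT' (IsRationalReflectedPath.staysAway_of_staysAway hp hp' hT))
  refine ⟨B, hB, fun w p ℓ h => ⟨fun hw => ?_, fun hT => hB1 ⟨(w, p, ℓ), ⟨h, hT⟩, rfl⟩⟩⟩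
  by_contra hT
  exact Set.disjoint_left.1 hB2 ⟨(w, p, ℓ), ⟨h, hT⟩, rfl⟩ hw

end RationalPath

/-! ### Diffusive rescaling of paths. -/

section Scaling

variable {d : ℕ} {D A : Set (EuclideanSpace ℝ (Fin d))} {σ : Matrix (Fin d) (Fin d) ℝ}
  {x : EuclideanSpace ℝ (Fin d)} {w p : ℝ≥0 → EuclideanSpace ℝ (Fin d)} {Λ : ℝ}

/-- The path `t ↦ Λ⁻¹ • f (Λ² t)`, at rational times. -/
def diffusiveRescaling {E : Type*} [SMul ℝ E] (Λ : ℝ) (f : ℝ≥0 → E) (q : ℚ≥0) : E :=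
  Λ⁻¹ • f (Real.toNNReal (Λ ^ 2) * q)

lemma exists_nnrat_btwn_nnreal {a b : ℝ≥0} (h : a < b) : ∃ q : ℚ≥0, a < q ∧ (q : ℝ≥0) < b := by
  obtain ⟨q, hq0, h1, h2⟩ := (NNReal.lt_iff_exists_rat_btwn a b).1 h
  lift q to ℚ≥0 using hq0
  have hq : (q : ℝ≥0) = Real.toNNReal ((q : ℚ) : ℝ) := by
    ext
    rw [Real.coe_toNNReal _ (by exact_mod_cast q.2)]
    rfl
  exact ⟨q, by rwa [hq], by rwa [hq]⟩

/-- By continuity, a hit of `Λ • A` at a real time makes the distance arbitrarily small at rational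
times. Conversely, on a compact time interval the distance attains its minimum, which is positive if
there is no hit. -/
lemma staysAway_diffusiveRescaling_iff (hΛ : 0 < Λ) (hA : IsClosed A) (hAne : A.Nonempty)
    (hp : Continuous p) (T : ℚ≥0) :
    StaysAway A (diffusiveRescaling Λ p) T ↔
      ∀ s ≤ Real.toNNReal (Λ ^ 2) * T, p s ∉ Λ • A := by
  set c := Real.toNNReal (Λ ^ 2) with hc
  have hc0 : 0 < c := Real.toNNReal_pos.2 (by positivity)
  have hmem (s : ℝ≥0) : p s ∈ Λ • A ↔ Metric.infDist (Λ⁻¹ • p s) A = 0 := by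
    rw [mem_smul_set_iff_inv_smul_mem₀ hΛ.ne', hA.mem_iff_infDist_zero hAne]
  have hcont : Continuous fun s => Metric.infDist (Λ⁻¹ • p s) A :=
    (Metric.continuous_infDist_pt A).comp (continuous_const_smul Λ⁻¹ |>.comp hp)
  constructor
  · rintro ⟨n, hn⟩ s hs hsA
    have hn0 : (0 : ℝ) < 1 / ((n : ℝ) + 1) := by positivity
    rw [hmem] at hsA
    -- A hit at the right endpoint is at a rational rescaled time; an earlier hit leaves room for a
    -- rational time just after it.
    obtain rfl | hlt := hs.eq_or_lt
    · have := hn T le_rfl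
      simp only [diffusiveRescaling, ← hc] at this
      linarith
    · have hev : ∀ᶠ t in 𝓝 s, t < c * T ∧ Metric.infDist (Λ⁻¹ • p t) A < 1 / ((n : ℝ) + 1) :=
        (gt_mem_nhds hlt).and (hcont.continuousAt.eventually (gt_mem_nhds (hsA.trans_lt hn0)))
      obtain ⟨b, hb, hsb⟩ := exists_Ico_subset_of_mem_nhds hev ⟨_, hlt⟩
      have hdiv : s / c < b / c := by gcongr
      obtain ⟨q, hq1, hq2⟩ := exists_nnrat_btwn_nnreal hdiv
      rw [div_lt_iff₀' hc0] at hq1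
      rw [lt_div_iff₀' hc0] at hq2
      obtain ⟨h1, h2⟩ := hsb ⟨hq1.le, hq2⟩
      have hqT : q ≤ T := by
        have := (lt_of_mul_lt_mul_left h1 hc0.le).le
        exact_mod_cast this
      exact (hn q hqT).not_gt h2
  · intro h
    obtain ⟨s, hs, hmin⟩ := (isCompact_Icc (a := (0 : ℝ≥0)) (b := c * T)).exists_isMinOn
      ⟨0, by simp⟩ hcont.continuousOn
    have hpos : 0 < Metric.infDist (Λ⁻¹ • p s) A :=
      lt_of_le_of_ne Metric.infDist_nonneg fun h0 => h s hs.2 ((hmem s).2 h0.symm)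
    obtain ⟨n, hn⟩ := exists_nat_one_div_lt hpos
    refine ⟨n, fun r hr => hn.le.trans (hmin ⟨zero_le, ?_⟩)⟩
    have : (r : ℝ≥0) ≤ T := by exact_mod_cast hr
    gcongr

/-- A reflected path in `Λ • D` becomes, after diffusive rescaling, one in `D`. -/
lemma IsReflectedPath.diffusiveRescaling (hΛ : 0 < Λ) (hD : IsOpen D) (hA : IsClosed A)
    (hAne : A.Nonempty) (hR : ∀ p ∈ frontier D \ A, ∃ ρ, IsDefiningFunctionAt D p ρ)
    {ℓ : StieltjesFunction ℝ≥0} (hp : IsReflectedPath (Λ • D) (Λ • A) σ x w p ℓ) :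
    IsRationalReflectedPath D A σ (Λ⁻¹ • x) (diffusiveRescaling Λ w) (diffusiveRescaling Λ p)
      (diffusiveRescaling Λ ℓ) := by
  set c := Real.toNNReal (Λ ^ 2) with hc
  have hc0 : (0 : ℝ) < c := Real.toNNReal_pos.2 (by positivity)
  have hmono {s t : ℚ≥0} (h : s ≤ t) : c * (s : ℝ≥0) ≤ c * t := by
    have : (s : ℝ≥0) ≤ t := by exact_mod_cast h
    gcongr
  have hmesh {δ : ℝ} (hδ : 0 < δ) : ∃ N : ℕ, ∀ s t : ℚ≥0, t ≤ s + 1 / ((N : ℚ≥0) + 1) →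
      ((c * t : ℝ≥0) : ℝ) ≤ ((c * s : ℝ≥0) : ℝ) + δ := by
    obtain ⟨N, hN⟩ := exists_nat_one_div_lt (div_pos hδ hc0)
    refine ⟨N, fun s t h => ?_⟩
    have h1 : ((t : ℝ≥0) : ℝ) ≤ ((s : ℝ≥0) : ℝ) + 1 / ((N : ℝ) + 1) := by
      have h2 : (t : ℝ≥0) ≤ ((s + 1 / ((N : ℚ≥0) + 1) : ℚ≥0) : ℝ≥0) := NNRat.cast_le.2 h
      push_cast at h2
      exact_mod_cast h2
    rw [lt_div_iff₀' hc0] at hN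
    push_cast
    nlinarith
  refine ⟨?_, fun T m => ?_, fun T hT => ?_⟩
  · simp [_root_.diffusiveRescaling, hp.start]
  · have huc : UniformContinuousOn p (Icc 0 (c * (T : ℝ≥0))) :=
      isCompact_Icc.uniformContinuousOn_of_continuous hp.continuous_path.continuousOn
    have hm : 0 < Λ * (1 / ((m : ℝ) + 1)) := by positivity
    obtain ⟨δ, hδ, h⟩ := Metric.uniformContinuousOn_iff_le.1 huc _ hm
    obtain ⟨N, hN⟩ := hmesh hδ
    refine ⟨N, fun s t hst htT hN' => ?_⟩
    have h1 := h (c * t) ⟨zero_le, hmono htT⟩ (c * s) ⟨zero_le, hmono (hst.trans htT)⟩ (by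
      have h2 : ((c * s : ℝ≥0) : ℝ) ≤ ((c * t : ℝ≥0) : ℝ) := hmono hst
      rw [NNReal.dist_eq, abs_of_nonneg (sub_nonneg.2 h2)]
      linarith [hN s t hN'])
    rw [dist_eq_norm] at h1
    simp only [_root_.diffusiveRescaling, ← hc]
    rw [← smul_sub, norm_smul, Real.norm_of_nonneg (by positivity)]
    rwa [inv_mul_le_iff₀ hΛ]
  · rw [staysAway_diffusiveRescaling_iff hΛ hA hAne hp.continuous_path] at hT
    obtain ⟨C, hC, hest⟩ := hp.exists_estimate (hD.smul₀ hΛ.ne') (hA.smul_of_ne_zero hΛ.ne')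
      (exists_isDefiningFunctionAt_smul hΛ hR) hT
    -- The exterior sphere constant scales like an inverse length, hence `C * Λ`; the ceiling is
    -- there because `IsRationalReflectedPath` wants a natural number.
    refine ⟨⌈C * Λ⌉₊, fun m => ?_⟩
    have hm : 0 < Λ * (1 / ((m : ℝ) + 1)) := by positivity
    obtain ⟨δ, hδ, h⟩ := hest _ hm
    obtain ⟨N, hN⟩ := hmesh hδ
    refine ⟨N, fun s t hst htT hN' => ?_⟩
    have hpush : pushIncrement σ (_root_.diffusiveRescaling Λ w) (_root_.diffusiveRescaling Λ p)
        s t = Λ⁻¹ • pushIncrement σ w p (c * s) (c * t) := by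
      simp only [pushIncrement, _root_.diffusiveRescaling, ← hc, ← smul_sub, map_smul]
    have hloc : _root_.diffusiveRescaling Λ ℓ t - _root_.diffusiveRescaling Λ ℓ s
        = Λ⁻¹ * (ℓ (c * t) - ℓ (c * s)) := by
      simp only [_root_.diffusiveRescaling, ← hc, smul_eq_mul, mul_sub]
    have hcl : closure (Λ • D) = Λ • closure D := closure_smul₀ Λ D
    have hsT := hmono (hst.trans htT)
    obtain ⟨h1, h2⟩ := h (c * s) (c * t) (hmono hst) (hmono htT) (hN s t hN')
    rw [hpush, hloc]
    refine ⟨?_, ?_, fun y hy => ?_⟩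
    · have := hp.mem_closure (c * s) fun r hr => hT r (hr.le.trans hsT)
      rwa [hcl, mem_smul_set_iff_inv_smul_mem₀ hΛ.ne'] at this
    · rw [norm_smul, Real.norm_of_nonneg (by positivity)]
      gcongr
    · have h3 := h2 (Λ • y) (by rw [hcl]; exact smul_mem_smul_set hy)
      have h4 : Λ • y - p (c * s) = Λ • (y - _root_.diffusiveRescaling Λ p s) := by
        simp only [_root_.diffusiveRescaling, ← hc, smul_sub, smul_inv_smul₀ hΛ.ne']
      set u := y - _root_.diffusiveRescaling Λ p s
      set k := pushIncrement σ w p (c * s) (c * t)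
      set L := ℓ (c * t) - ℓ (c * s)
      have hL : 0 ≤ L := sub_nonneg.2 (ℓ.mono (hmono hst))
      rw [h4, real_inner_smul_left, norm_smul, Real.norm_of_nonneg hΛ.le] at h3
      rw [real_inner_smul_right]
      have h5 : inner ℝ u k ≤ (C * Λ * ‖u‖ ^ 2 + 1 / ((m : ℝ) + 1)) * L := by
        refine le_of_mul_le_mul_left (h3.trans_eq ?_) hΛ
        ring
      have h6 : (C * Λ * ‖u‖ ^ 2 + 1 / ((m : ℝ) + 1)) * L ≤
          (⌈C * Λ⌉₊ * ‖u‖ ^ 2 + 1 / ((m : ℝ) + 1)) * L := by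
        gcongr
        exact Nat.le_ceil _
      calc _ ≤ Λ⁻¹ * ((⌈C * Λ⌉₊ * ‖u‖ ^ 2 + 1 / ((m : ℝ) + 1)) * L) := by
            gcongr; exact h5.trans h6
        _ = _ := by ring

end Scaling

/-! ### Exit times of continuous paths. -/

section ExitTime

variable {d : ℕ} {S : Type*} {A : Set (EuclideanSpace ℝ (Fin d))}
  {X : ℝ≥0 → S → EuclideanSpace ℝ (Fin d)} {ω : S}

lemma coe_lt_exitTime_iff (hA : IsClosed A) (hX : Continuous fun t => X t ω) (T : ℝ≥0) :
    (T : ℝ≥0∞) < exitTime A X ω ↔ ∀ s ≤ T, X s ω ∉ A := by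
  unfold exitTime hittingAfter
  split_ifs with h
  · have hcl : IsClosed {i : ℝ≥0 | 0 ≤ i ∧ X i ω ∈ A} := by
      have : {i : ℝ≥0 | 0 ≤ i ∧ X i ω ∈ A} = (fun t => X t ω) ⁻¹' A := by ext; simp
      rw [this]
      exact hA.preimage hX
    have hmem := hcl.csInf_mem h (OrderBot.bddBelow _)
    change (T : ℝ≥0∞) < ((sInf {i : ℝ≥0 | 0 ≤ i ∧ X i ω ∈ A} : ℝ≥0) : ℝ≥0∞) ↔ _
    rw [ENNReal.coe_lt_coe]
    refine ⟨fun hT s hs hsA => ?_, fun hT => ?_⟩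
    · exact (csInf_le (OrderBot.bddBelow _)
        (show s ∈ {i : ℝ≥0 | 0 ≤ i ∧ X i ω ∈ A} from ⟨zero_le, hsA⟩)).not_gt (hs.trans_lt hT)
    · by_contra! hle
      exact hT _ hle hmem.2
  · exact iff_of_true ENNReal.coe_lt_top fun s _ hs => h ⟨s, zero_le, hs⟩

end ExitTime

/-! ### Brownian scaling of the law of the noise. -/

section Law

/-- Finite-dimensional marginals determine the law as a projective limit. Since `φ` need not be
injective, the marginals are taken over the image of the index set under `φ` and then pulled back.
-/
lemma ProbabilityTheory.IsPreBrownianReal.map_eq_map {S S' T : Type*} [MeasurableSpace S]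
    [MeasurableSpace S'] [Countable T] {P : Measure S} {P' : Measure S'} {B : ℝ≥0 → S → ℝ}
    {B' : ℝ≥0 → S' → ℝ} (hB : IsPreBrownianReal B P) (hB' : IsPreBrownianReal B' P')
    (φ : T → ℝ≥0) :
    P.map (fun ω t => B (φ t) ω) = P'.map (fun ω t => B' (φ t) ω) := by
  classical
  have hm : AEMeasurable (fun ω t => B (φ t) ω) P :=
    aemeasurable_pi_lambda _ fun t => hB.aemeasurable (φ t)
  have hm' : AEMeasurable (fun ω t => B' (φ t) ω) P' :=
    aemeasurable_pi_lambda _ fun t => hB'.aemeasurable (φ t)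
  have : IsProbabilityMeasure P := hB.isGaussianProcess.isProbabilityMeasure
  have h := isProjectiveLimit_map hm
  have h' := isProjectiveLimit_map hm'
  refine h.unique (P := fun I : Finset T => P.map fun ω => I.restrict fun t => B (φ t) ω) ?_
  convert h' using 1
  funext I
  have hrestrict : Measurable fun (x : I.image φ → ℝ) (i : I) =>
      x ⟨φ i, Finset.mem_image_of_mem φ i.2⟩ := by fun_prop
  have e := (hB.hasLaw (I.image φ)).map_eq.trans (hB'.hasLaw (I.image φ)).map_eq.symm
  have e' := congrArg (Measure.map fun (x : I.image φ → ℝ) (i : I) =>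
      x ⟨φ i, Finset.mem_image_of_mem φ i.2⟩) e
  rwa [AEMeasurable.map_map_of_aemeasurable hrestrict.aemeasurable
      (hB.hasLaw (I.image φ)).aemeasurable,
    AEMeasurable.map_map_of_aemeasurable hrestrict.aemeasurable
      (hB'.hasLaw (I.image φ)).aemeasurable] at e'

variable {d : ℕ} {S S' : Type*} [MeasurableSpace S] [MeasurableSpace S']
  {P : Measure S} {P' : Measure S'} {W : ℝ≥0 → S → EuclideanSpace ℝ (Fin d)}
  {W' : ℝ≥0 → S' → EuclideanSpace ℝ (Fin d)} {Λ Λ' : ℝ}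

lemma IsWienerProcess.isPreBrownianReal_rescaling (hW : IsWienerProcess P W) (hΛ : 0 < Λ)
    (i : Fin d) :
    IsPreBrownianReal (fun t ω => Λ⁻¹ * W (Real.toNNReal (Λ ^ 2) * t) ω i) P := by
  have hc : Real.toNNReal (Λ ^ 2) ≠ 0 := (Real.toNNReal_pos.2 (by positivity)).ne'
  have h := (hW.isBrownianReal i).toIsPreBrownianReal.smul hc
  rwa [Real.coe_toNNReal _ (by positivity), Real.sqrt_sq hΛ.le] at h

lemma IsWienerProcess.aemeasurable_coord_rescaling (hW : IsWienerProcess P W) (hΛ : 0 < Λ)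
    (i : Fin d) :
    AEMeasurable (fun ω (q : ℚ≥0) => Λ⁻¹ * W (Real.toNNReal (Λ ^ 2) * q) ω i) P :=
  aemeasurable_pi_lambda _ fun q => (hW.isPreBrownianReal_rescaling hΛ i).aemeasurable q

/-- Reassemble the coordinate processes into a vector-valued process. -/
def assembleCoords {T : Type*} (f : Fin d → T → ℝ) (t : T) : EuclideanSpace ℝ (Fin d) :=
  WithLp.toLp 2 fun i => f i t

lemma measurable_assembleCoords {T : Type*} :
    Measurable (assembleCoords (d := d) (T := T)) := by
  unfold assembleCoords
  fun_prop

lemma diffusiveRescaling_eq_assembleCoords {S : Type*}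
    {W : ℝ≥0 → S → EuclideanSpace ℝ (Fin d)} (ω : S) :
    diffusiveRescaling Λ (fun t => W t ω) =
      assembleCoords fun i (q : ℚ≥0) => Λ⁻¹ * W (Real.toNNReal (Λ ^ 2) * q) ω i := by
  funext q
  ext i
  simp [diffusiveRescaling, assembleCoords]

lemma IsWienerProcess.aemeasurable_rescaling (hW : IsWienerProcess P W) (hΛ : 0 < Λ) :
    AEMeasurable (fun ω => diffusiveRescaling Λ fun t => W t ω) P := by
  simp_rw [diffusiveRescaling_eq_assembleCoords]
  exact measurable_assembleCoords.comp_aemeasurable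
    (aemeasurable_pi_lambda _ fun i => hW.aemeasurable_coord_rescaling hΛ i)

lemma IsWienerProcess.map_coord_rescaling (hW : IsWienerProcess P W)
    [IsProbabilityMeasure P] (hΛ : 0 < Λ) :
    P.map (fun ω i (q : ℚ≥0) => Λ⁻¹ * W (Real.toNNReal (Λ ^ 2) * q) ω i) =
      Measure.pi fun i => P.map fun ω (q : ℚ≥0) => Λ⁻¹ * W (Real.toNNReal (Λ ^ 2) * q) ω i := by
  have hind := hW.iIndepFun.comp (fun _ (f : ℝ≥0 → ℝ) (q : ℚ≥0) =>
    Λ⁻¹ * f (Real.toNNReal (Λ ^ 2) * q)) fun i => by fun_prop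
  exact (iIndepFun_iff_map_fun_eq_pi_map fun i => hW.aemeasurable_coord_rescaling hΛ i).1 hind

/-- **Brownian scaling**: all diffusive rescalings of Wiener processes have the same law. -/
lemma IsWienerProcess.map_rescaling_eq (hW : IsWienerProcess P W) (hW' : IsWienerProcess P' W')
    [IsProbabilityMeasure P] [IsProbabilityMeasure P'] (hΛ : 0 < Λ) (hΛ' : 0 < Λ') :
    P.map (fun ω => _root_.diffusiveRescaling Λ fun t => W t ω) =
      P'.map (fun ω => _root_.diffusiveRescaling Λ' fun t => W' t ω) := by
  simp_rw [diffusiveRescaling_eq_assembleCoords]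
  rw [← Function.comp_def assembleCoords, ← Function.comp_def assembleCoords,
    ← AEMeasurable.map_map_of_aemeasurable measurable_assembleCoords.aemeasurable
      (aemeasurable_pi_lambda _ fun i => hW.aemeasurable_coord_rescaling hΛ i),
    ← AEMeasurable.map_map_of_aemeasurable measurable_assembleCoords.aemeasurable
      (aemeasurable_pi_lambda _ fun i => hW'.aemeasurable_coord_rescaling hΛ' i),
    hW.map_coord_rescaling hΛ, hW'.map_coord_rescaling hΛ']
  congr 2
  funext i
  exact (hW.isPreBrownianReal_rescaling hΛ i).map_eq_map
    (hW'.isPreBrownianReal_rescaling hΛ' i) fun q : ℚ≥0 => (q : ℝ≥0)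

end Law

/-! ### The exit time as a functional of the noise, and its expectation. -/

section Expectation

variable {d : ℕ} {D A : Set (EuclideanSpace ℝ (Fin d))} {σ : Matrix (Fin d) (Fin d) ℝ}
  {x : EuclideanSpace ℝ (Fin d)}

/-- The exit time as a measurable functional of the (rescaled) noise. -/
lemma exists_exitTime_functional (hD : IsOpen D) (hA : IsClosed A) (hAne : A.Nonempty)
    (hR : ∀ p ∈ frontier D \ A, ∃ ρ, IsDefiningFunctionAt D p ρ)
    (σ : Matrix (Fin d) (Fin d) ℝ) (x : EuclideanSpace ℝ (Fin d)) :
    ∃ F : (ℚ≥0 → EuclideanSpace ℝ (Fin d)) → ℝ≥0∞, Measurable F ∧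
      ∀ (Λ : ℝ), 0 < Λ → ∀ (w p : ℝ≥0 → EuclideanSpace ℝ (Fin d)) (ℓ : StieltjesFunction ℝ≥0),
        IsReflectedPath (Λ • D) (Λ • A) σ (Λ • x) w p ℓ →
        exitTime (Λ • A) (fun t (_ : Unit) => p t) () =
          ENNReal.ofReal (Λ ^ 2) * F (diffusiveRescaling Λ w) := by
  choose B hB hBiff using exists_measurableSet_staysAway D A σ x
  -- The supremum of the rational `T` up to which `A` is avoided. It does not involve `Λ`, so one
  -- functional serves all scales.
  refine ⟨fun w => ⨆ T : ℚ≥0, (B T).indicator (fun _ => ((T : ℝ≥0) : ℝ≥0∞)) w,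
    Measurable.iSup fun T => measurable_const.indicator (hB T), ?_⟩
  intro Λ hΛ w p ℓ hp
  have hr := hp.diffusiveRescaling hΛ hD hA hAne hR
  rw [inv_smul_smul₀ hΛ.ne'] at hr
  have key (T : ℚ≥0) : diffusiveRescaling Λ w ∈ B T ↔
      ((Real.toNNReal (Λ ^ 2) * T : ℝ≥0) : ℝ≥0∞) < exitTime (Λ • A) (fun t (_ : Unit) => p t) () := by
    rw [hBiff T _ _ _ hr, staysAway_diffusiveRescaling_iff hΛ hA hAne hp.continuous_path,
      coe_lt_exitTime_iff (ω := ()) (hA.smul_of_ne_zero hΛ.ne') hp.continuous_path]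
  set c := Real.toNNReal (Λ ^ 2) with hc
  have hc0 : 0 < c := Real.toNNReal_pos.2 (by positivity)
  have hcE : ENNReal.ofReal (Λ ^ 2) = c := rfl
  rw [hcE, ENNReal.mul_iSup]
  refine le_antisymm (le_of_forall_lt fun a ha => ?_) (iSup_le fun T => ?_)
  · obtain ⟨r, har, hr⟩ := ENNReal.lt_iff_exists_nnreal_btwn.1 ha
    obtain ⟨r', hrr', hr'⟩ := ENNReal.lt_iff_exists_nnreal_btwn.1 hr
    have hdiv : r / c < r' / c := by
      have := ENNReal.coe_lt_coe.1 hrr'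
      gcongr
    obtain ⟨T, hT1, hT2⟩ := exists_nnrat_btwn_nnreal hdiv
    rw [div_lt_iff₀' hc0] at hT1
    rw [lt_div_iff₀' hc0] at hT2
    have hmem := (key T).2 ((ENNReal.coe_lt_coe.2 hT2).trans hr')
    refine lt_of_lt_of_le ?_ (le_iSup _ T)
    rw [indicator_of_mem hmem, ← ENNReal.coe_mul]
    exact har.trans (ENNReal.coe_lt_coe.2 hT1)
  · by_cases hmem : diffusiveRescaling Λ w ∈ B T
    · rw [indicator_of_mem hmem, ← ENNReal.coe_mul]
      exact ((key T).1 hmem).le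
    · simp [indicator_of_notMem hmem]

lemma IsReflectedDiffusion.lintegral_exitTime {S : Type*} [MeasurableSpace S] {P : Measure S}
    {Λ : ℝ} (hΛ : 0 < Λ) {X W : ℝ≥0 → S → EuclideanSpace ℝ (Fin d)} {ξ : ℝ≥0 → S → ℝ}
    (hX : IsReflectedDiffusion P (Λ • D) (Λ • A) σ (Λ • x) X W ξ)
    {F : (ℚ≥0 → EuclideanSpace ℝ (Fin d)) → ℝ≥0∞} (hF : Measurable F)
    (hFX : ∀ (w p : ℝ≥0 → EuclideanSpace ℝ (Fin d)) (ℓ : StieltjesFunction ℝ≥0),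
      IsReflectedPath (Λ • D) (Λ • A) σ (Λ • x) w p ℓ →
      exitTime (Λ • A) (fun t (_ : Unit) => p t) () =
        ENNReal.ofReal (Λ ^ 2) * F (diffusiveRescaling Λ w)) :
    ∫⁻ ω, exitTime (Λ • A) X ω ∂P = ENNReal.ofReal (Λ ^ 2) *
      ∫⁻ w, F w ∂P.map (fun ω => diffusiveRescaling Λ fun t => W t ω) := by
  rw [lintegral_map' hF.aemeasurable (hX.wiener.aemeasurable_rescaling hΛ),
    ← lintegral_const_mul' _ _ ENNReal.ofReal_ne_top]
  refine lintegral_congr_ae ?_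
  filter_upwards [hX.path] with ω ⟨ℓ, _, hℓ⟩
  exact hFX _ _ ℓ hℓ

end Expectation

end

theorem lemma13 {d : ℕ} (D A : Set (EuclideanSpace ℝ (Fin d)))
    (hD_open : IsOpen D) (hD_conn : IsConnected D) (hD_bdd : Bornology.IsBounded D)
    (hA_sub : A ⊆ frontier D) (hA_closed : IsClosed A) (hA_ne : A.Nonempty)
    (hR : ∀ p ∈ frontier D \ A, ∃ ρ, IsDefiningFunctionAt D p ρ)
    (σ : Matrix (Fin d) (Fin d) ℝ) (κ : ℝ) (hκ : 0 < κ)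
    (hσ : ∀ f : EuclideanSpace ℝ (Fin d) → ℝ, ContDiff ℝ 2 f →
      ∀ x, diffusionGenerator σ f x = κ * Laplacian.laplacian f x)
    (Λ : ℝ) (hΛ : 0 < Λ)
    (z : EuclideanSpace ℝ (Fin d)) (hz : z ∈ closure (Λ • D))
    {S S' : Type*} [MeasurableSpace S] [MeasurableSpace S']
    (P : Measure S) [IsProbabilityMeasure P] (P' : Measure S') [IsProbabilityMeasure P']
    (X W : ℝ≥0 → S → EuclideanSpace ℝ (Fin d)) (ξ : ℝ≥0 → S → ℝ)
    (X' W' : ℝ≥0 → S' → EuclideanSpace ℝ (Fin d)) (ξ' : ℝ≥0 → S' → ℝ)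
    (hX : IsReflectedDiffusion P D A σ (Λ⁻¹ • z) X W ξ)
    (hX' : IsReflectedDiffusion P' (Λ • D) (Λ • A) σ z X' W' ξ') :
    ∫⁻ ω, exitTime (Λ • A) X' ω ∂P' =
      ENNReal.ofReal (Λ ^ 2) * ∫⁻ ω, exitTime A X ω ∂P := by
  obtain ⟨F, hF, hFX⟩ := exists_exitTime_functional hD_open hA_closed hA_ne hR σ (Λ⁻¹ • z)
  -- The diffusion in `D` is the case of scale `1`, so both expectations are integrals of the same
  -- `F`.
  have hX₁ : IsReflectedDiffusion P ((1 : ℝ) • D) ((1 : ℝ) • A) σ ((1 : ℝ) • Λ⁻¹ • z) X W ξ := by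
    simpa only [one_smul] using hX
  have hX₂ : IsReflectedDiffusion P' (Λ • D) (Λ • A) σ (Λ • Λ⁻¹ • z) X' W' ξ' := by
    rwa [smul_inv_smul₀ hΛ.ne']
  have h₁ := hX₁.lintegral_exitTime one_pos hF (hFX 1 one_pos)
  have h₂ := hX₂.lintegral_exitTime hΛ hF (hFX Λ hΛ)
  rw [one_smul, one_pow, ENNReal.ofReal_one, one_mul] at h₁
  rw [h₁, h₂, hX₂.wiener.map_rescaling_eq hX₁.wiener hΛ one_pos]
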